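/- Consider a rooted tree with buses $0,1,\dots,n$ and root $0$; write $\pi(j)$ for the parent of a bus $j\neq 0$, $\delta(j)$ for the set of children of $j$, and $E=\{(\pi(j),j): j\ne 0\}$ for its lines. Each line $(i,j)\in E$ has a resistance $r_{ij}\ge 0$ and a reactance $x_{ij}\ge 0$. The variables are real numbers $p_{ij},q_{ij},\ell_{ij}$ for $(i,j)\in E$ (sending-end active and reactive power, squared current magnitude) and $v_i,p_i,q_i$ for each bus $i$ (squared voltage magnitude, net active and reactive power demand), and the relaxed branch flow equations are $$p_j = p_{\pi(j)j}-r_{\pi(j)j}\ell_{\pi(j)j}-\sum_{k\in\delta(j)}p_{jk},\qquad q_j = q_{\pi(j)j}-x_{\pi(j)j}\ell_{\pi(j)j}-\sum_{k\in\delta(j)}q_{jk}$$ for every bus $j$ (for $j=0$ the terms with $\pi(0)0$ are $0$), and $$v_j=v_i-2(r_{ij}p_{ij}+x_{ij}q_{ij})+(r_{ij}^2+x_{ij}^2)\ell_{ij},\qquad v_i\ell_{ij}=p_{ij}^2+q_{ij}^2$$ for every $(i,j)\in E$. Put $u=(\overline p,\overline q,\ell,v_{1\ldots n},p_0,q_0)\in\mathbb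 R^{4n+2}$, where $\overline p=(p_{ij})$, $\overline q=(q_{ij})$, $\ell=(\ell_{ij})$ over the lines, and $\xi=(v_0,p_{1\ldots n},q_{1\ldots n})$. Write the equations as $\varphi(u,\xi)=0$, with $\varphi$ equal to right-hand side minus left-hand side, and let $\varphi_u=\partial\varphi/\partial u$. The flat voltage solution is $v=\mathbf 1$, all other variables $0$. The voltage stability region of the network with PQ loads is the connected component of the flat voltage solution in the set of all $(u,\xi)$ with $\varphi(u,\xi)=0$, $v_0=1$, $p_j\ge 0$ and $q_j\ge0$ for $j=1,\dots,n$, and $\det\varphi_u\neq0$. Let $A^o$ and $A^i$ be the $(n+1)\times n$ matrices, with rows indexed by buses and columns by lines, whose entry at bus $k$ and line $(i,j)$ is $1$ if $k=i$, respectively if $k=j$, and $0$ otherwise. Put $A=A^o-A^i$, and let $A_2^o$, $A_2$ be $A^o$, $A$ without the row of bus $0$; write $[y]$ for the diagonal matrix with diagonal $y$. The reduced power flow Jacobian is $$\varphi_u'=[A^{oT}v]+2[\overline p]A_2^{-1}[r]+2[\overline q]A_2^{-1}[x]-[\ell]A_2^{oT}(A_2^T)^{-1}\big([r]^2+2[r]A_2^{-1}[r]+[x]^2+2[x]A_2^{-1}[x]\big).$$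 Then at every point of the voltage stability region (in particular at those with positive active and reactive demand at all buses $1,\dots,n$) the diagonal entries of $\varphi'_u$ are $$\varphi'_{u,jj}=v_i-2p_{ij}r_{ij}-2q_{ij}x_{ij}-2\ell_{ij}\big(r_{ij}\overline{r_{0i}}+x_{ij}\overline{x_{0i}}\big),\qquad i=\pi(j),$$ where $\overline{r_{0i}}$ and $\overline{x_{0i}}$ are the sums of the resistances and of the reactances of the lines connecting bus $0$ to bus $i$, and $$0<\det(\varphi_u')\le{\det}_{\mathrm{approx}}:=\prod_{(i,j)\in E}\varphi'_{u,jj}.$$ -/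

import Mathlib

open Matrix

/-- One step towards the root `0`: the root stays where it is, the bus `j.succ` moves to its parent. -/
def towardsRoot {n : ℕ} (parent : Fin n → Fin (n + 1)) : Fin (n + 1) → Fin (n + 1) :=
  Fin.cons (α := fun _ => Fin (n + 1)) 0 parent

/-- A radial distribution network with buses `0, 1, …, n`, where bus `0` is the root (the substation).
The bus `j.succ` (for `j : Fin n`) has the unique parent `parent j`; the line from `parent j` to
`j.succ` is indexed by `j`, and `r j`, `x j` are its resistance and reactance. -/
structure RadialNetwork (n : ℕ) where
  parent : Fin n → Fin (n + 1)
  reaches_root : ∀ i : Fin (n + 1), ∃ k : ℕ, (towardsRoot parent)^[k] i = 0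
  r : Fin n → ℝ
  x : Fin n → ℝ
  r_nonneg : ∀ j, 0 ≤ r j
  x_nonneg : ∀ j, 0 ≤ x j

/-- Positions of the vector of system variables `u = (p̄, q̄, ℓ, v₁…vₙ, p₀, q₀)`, in this order. -/
abbrev VarIdx (n : ℕ) : Type := Fin n ⊕ Fin n ⊕ Fin n ⊕ Fin n ⊕ Fin 1 ⊕ Fin 1

/-- Positions of the vector of system parameters `ξ = (v₀, p₁…pₙ, q₁…qₙ)`, in this order. -/
abbrev ParIdx (n : ℕ) : Type := Fin 1 ⊕ Fin n ⊕ Fin n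

/-- Positions of the branch flow equations: active power balance, reactive power balance,
voltage drop, and current equation, in this order. -/
abbrev EqIdx (n : ℕ) : Type := Fin (n + 1) ⊕ Fin (n + 1) ⊕ Fin n ⊕ Fin n

abbrev Vars (n : ℕ) : Type := VarIdx n → ℝ

abbrev Params (n : ℕ) : Type := ParIdx n → ℝ

namespace Vars

variable {n : ℕ}

/-- Sending-end active power of each line. -/
def pLine (u : Vars n) : Fin n → ℝ := fun j => u (.inl j)

/-- Sending-end reactive power of each line. -/
def qLine (u : Vars n) : Fin n → ℝ := fun j => u (.inr (.inl j))

/-- Squared current magnitude of each line. -/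
def ell (u : Vars n) : Fin n → ℝ := fun j => u (.inr (.inr (.inl j)))

/-- Squared voltage magnitude at the PQ buses `1, …, n`. -/
def vPQ (u : Vars n) : Fin n → ℝ := fun j => u (.inr (.inr (.inr (.inl j))))

/-- Active power demand at the slack bus. -/
def pSlack (u : Vars n) : ℝ := u (.inr (.inr (.inr (.inr (.inl 0)))))

/-- Reactive power demand at the slack bus. -/
def qSlack (u : Vars n) : ℝ := u (.inr (.inr (.inr (.inr (.inr 0)))))

end Vars

namespace Params

variable {n : ℕ}

/-- Squared voltage magnitude at the slack bus. -/
def vSlack (ξ : Params n) : ℝ := ξ (.inl 0)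

/-- Active power demand (load minus generation) at the PQ buses. -/
def pPQ (ξ : Params n) : Fin n → ℝ := fun j => ξ (.inr (.inl j))

/-- Reactive power demand at the PQ buses. -/
def qPQ (ξ : Params n) : Fin n → ℝ := fun j => ξ (.inr (.inr j))

end Params

/-- The vector `v` of squared voltage magnitudes at all buses `0, …, n`. -/
def busV {n : ℕ} (u : Vars n) (ξ : Params n) : Fin (n + 1) → ℝ :=
  Fin.cons (α := fun _ => ℝ) ξ.vSlack u.vPQ

/-- The vector `p` of active power demands at all buses. -/
def busP {n : ℕ} (u : Vars n) (ξ : Params n) : Fin (n + 1) → ℝ :=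
  Fin.cons (α := fun _ => ℝ) u.pSlack ξ.pPQ

/-- The vector `q` of reactive power demands at all buses. -/
def busQ {n : ℕ} (u : Vars n) (ξ : Params n) : Fin (n + 1) → ℝ :=
  Fin.cons (α := fun _ => ℝ) u.qSlack ξ.qPQ

/-- The variables of the flat voltage solution: all voltages `1`, everything else `0`. -/
def flatVars (n : ℕ) : Vars n :=
  Sum.elim 0 (Sum.elim 0 (Sum.elim 0 (Sum.elim 1 (Sum.elim 0 0))))

/-- The parameters of the flat voltage solution: `v₀ = 1` and no demand. -/
def flatParams (n : ℕ) : Params n :=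
  Sum.elim 1 (Sum.elim 0 0)

/-- The parameters for which no PQ bus generates active or reactive power. It is the closure of the
set of parameters with positive demand at all PQ buses, and contains those of the flat voltage
solution. -/
def loadParams (n : ℕ) : Set (Params n) :=
  {ξ | ∀ j, 0 ≤ ξ.pPQ j ∧ 0 ≤ ξ.qPQ j}

/-- Stacking order of the equations. -/
def eqOrder (n : ℕ) : EqIdx n ≃ Fin (4 * n + 2) :=
  (((Equiv.refl _).sumCongr (((Equiv.refl _).sumCongr finSumFinEquiv).trans finSumFinEquiv)).trans
    finSumFinEquiv).trans (finCongr (by omega))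

/-- Stacking order of the variables. -/
def varOrder (n : ℕ) : VarIdx n ≃ Fin (4 * n + 2) :=
  (((Equiv.refl _).sumCongr (((Equiv.refl _).sumCongr (((Equiv.refl _).sumCongr
    (((Equiv.refl _).sumCongr finSumFinEquiv).trans finSumFinEquiv)).trans
      finSumFinEquiv)).trans finSumFinEquiv)).trans finSumFinEquiv).trans (finCongr (by omega))

noncomputable section

namespace RadialNetwork

variable {n : ℕ} (net : RadialNetwork n)

/-- `Aⁱ` selects for each bus the line that enters it. -/
def Ai (_net : RadialNetwork n) : Matrix (Fin (n + 1)) (Fin n) ℝ :=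
  Matrix.of fun i j => if i = j.succ then 1 else 0

/-- `Aᵒ` selects for each bus the lines that leave it. -/
def Ao : Matrix (Fin (n + 1)) (Fin n) ℝ :=
  Matrix.of fun i j => if i = net.parent j then 1 else 0

/-- The incidence matrix. -/
def A : Matrix (Fin (n + 1)) (Fin n) ℝ := net.Ao - net.Ai

/-- `Aᵒ` without the row of the root. -/
def Ao2 : Matrix (Fin n) (Fin n) ℝ := net.Ao.submatrix Fin.succ id

/-- `A` without the row of the root. -/
def A2 : Matrix (Fin n) (Fin n) ℝ := net.A.submatrix Fin.succ id

/-- The relaxed branch flow model in implicit form: right-hand side minus left-hand side of its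
vector equations. -/
def phi (u : Vars n) (ξ : Params n) : EqIdx n → ℝ :=
  Sum.elim
    (net.Ai *ᵥ (u.pLine - diagonal net.r *ᵥ u.ell) - net.Ao *ᵥ u.pLine - busP u ξ)
    (Sum.elim
      (net.Ai *ᵥ (u.qLine - diagonal net.x *ᵥ u.ell) - net.Ao *ᵥ u.qLine - busQ u ξ)
      (Sum.elim
        (net.Aoᵀ *ᵥ busV u ξ
          - (2 : ℝ) • (diagonal net.r *ᵥ u.pLine + diagonal net.x *ᵥ u.qLine)
          + (diagonal net.r ^ 2 + diagonal net.x ^ 2) *ᵥ u.ell - net.Aiᵀ *ᵥ busV u ξ)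
        (diagonal u.pLine *ᵥ u.pLine + diagonal u.qLine *ᵥ u.qLine
          - diagonal (net.Aoᵀ *ᵥ busV u ξ) *ᵥ u.ell)))

/-- The power flow Jacobian `φ_u = ∂φ/∂u`, a square matrix of size `4 n + 2`. -/
def jacobian (u : Vars n) (ξ : Params n) : Matrix (Fin (4 * n + 2)) (Fin (4 * n + 2)) ℝ :=
  Matrix.reindex (eqOrder n) (varOrder n)
    (Matrix.of fun i k => fderiv ℝ (fun w : Vars n => net.phi w ξ) u (Pi.single k 1) i)

/-- The reduced power flow Jacobian `φ'_u`. -/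
def reducedJacobian (u : Vars n) (ξ : Params n) : Matrix (Fin n) (Fin n) ℝ :=
  diagonal (net.Aoᵀ *ᵥ busV u ξ)
    + (2 : ℝ) • (diagonal u.pLine * net.A2⁻¹ * diagonal net.r)
    + (2 : ℝ) • (diagonal u.qLine * net.A2⁻¹ * diagonal net.x)
    - diagonal u.ell * net.Ao2ᵀ * (net.A2ᵀ)⁻¹
      * (diagonal net.r ^ 2 + (2 : ℝ) • (diagonal net.r * net.A2⁻¹ * diagonal net.r)
        + diagonal net.x ^ 2 + (2 : ℝ) • (diagonal net.x * net.A2⁻¹ * diagonal net.x))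

/-- The lines on the path that connects the root with bus `i`. -/
def pathLines (i : Fin (n + 1)) : Set (Fin n) :=
  {e | ∃ k : ℕ, (towardsRoot net.parent)^[k] i = e.succ}

/-- Sum of the resistances of the lines that connect the root with bus `i`. -/
def rPath (i : Fin (n + 1)) : ℝ := ∑ e, (net.pathLines i).indicator net.r e

/-- Sum of the reactances of the lines that connect the root with bus `i`. -/
def xPath (i : Fin (n + 1)) : ℝ := ∑ e, (net.pathLines i).indicator net.x e

/-- `v_i - 2 p_ij r_ij - 2 q_ij x_ij - 2 ℓ_ij (r_ij r̄_0i + x_ij x̄_0i)` for the line `(i, j)`,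
`i` the parent of `j`. -/
def diagEntry (u : Vars n) (ξ : Params n) (j : Fin n) : ℝ :=
  busV u ξ (net.parent j) - 2 * u.pLine j * net.r j - 2 * u.qLine j * net.x j
    - 2 * u.ell j * (net.r j * net.rPath (net.parent j) + net.x j * net.xPath (net.parent j))

/-- The determinant approximation. -/
def detApprox (u : Vars n) (ξ : Params n) : ℝ := ∏ j, net.diagEntry u ξ j

/-- The power flow solutions `(u, ξ)` with slack voltage `1`, parameters in `D`, and nonsingular
power flow Jacobian. -/
def regularSolutions (D : Set (Params n)) : Set (Vars n × Params n) :=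
  {s | net.phi s.1 s.2 = 0 ∧ s.2.vSlack = 1 ∧ s.2 ∈ D ∧ (net.jacobian s.1 s.2).det ≠ 0}

/-- The voltage stability region of a network whose parameters range over `D`: the connected region
around the flat voltage solution, among the power flow solutions, in which the power flow Jacobian
is nonsingular. -/
def voltageStabilityRegion (D : Set (Params n)) : Set (Vars n × Params n) :=
  connectedComponentIn (net.regularSolutions D) (flatVars n, flatParams n)

end RadialNetwork

end

/-! On the stability region the reduced Jacobian M is a nonsingular M-matrix, so its determinant is
positive and at most the product of its diagonal (`IsZMatrix.det_pos_and_le`). With nonnegative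
flows and currents M has nonpositive off-diagonal entries, and nonnegative loads make the flows
nonnegative once the currents are. Among such matrices, being a nonsingular M-matrix has an open
form (some x > 0 with Mx > 0) and, when det M ≠ 0, a closed form (det and adjugate nonnegative). A
singular M would make the full Jacobian singular (`reducedJacobian_det_ne_zero`), so at regular
solutions the two forms agree. Nonnegativity of currents is closed. It also persists nearby: a
positive diagonal entry of M forces a positive sending-end voltage, and vℓ = p² + q² then gives ℓ ≥
0. Hence the good states are relatively clopen among the regular solutions. They contain the flat
solution, where M = 1, so they contain its whole component. -/

/-! ### Z-matrices and nonsingular M-matrices. -/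

section ZMatrix

/-- Real square matrices with nonpositive off-diagonal entries. -/
def IsZMatrix {m : Type*} (M : Matrix m m ℝ) : Prop := ∀ i j, i ≠ j → M i j ≤ 0

namespace IsZMatrix

variable {m : Type*} [Fintype m]

/-- Off-diagonal terms contribute at most 0, so the diagonal term alone must make the row sum
positive. -/
theorem diag_mul_pos {M : Matrix m m ℝ} (hM : IsZMatrix M) {x : m → ℝ} (hx : ∀ i, 0 ≤ x i)
    {i : m} (hMx : 0 < (M *ᵥ x) i) : 0 < M i i * x i := by
  classical
  have h1 : (M *ᵥ x) i = M i i * x i + ∑ j ∈ Finset.univ.erase i, M i j * x j := by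
    rw [mulVec, dotProduct, ← Finset.add_sum_erase _ _ (Finset.mem_univ i)]
  have h2 : ∑ j ∈ Finset.univ.erase i, M i j * x j ≤ 0 :=
    Finset.sum_nonpos fun j hj =>
      mul_nonpos_of_nonpos_of_nonneg (hM i j (Finset.ne_of_mem_erase hj).symm) (hx j)
  linarith

theorem pos_of_nonneg {M : Matrix m m ℝ} (hM : IsZMatrix M) {x : m → ℝ} (hx : ∀ i, 0 ≤ x i)
    (hMx : ∀ i, 0 < (M *ᵥ x) i) (i : m) : 0 < x i := by
  refine lt_of_le_of_ne (hx i) fun h => ?_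
  have := hM.diag_mul_pos hx (hMx i)
  rw [← h, mul_zero] at this
  exact lt_irrefl _ this

theorem diag_pos {M : Matrix m m ℝ} (hM : IsZMatrix M) {x : m → ℝ} (hx : ∀ i, 0 ≤ x i)
    (hMx : ∀ i, 0 < (M *ᵥ x) i) (i : m) : 0 < M i i :=
  pos_of_mul_pos_left (hM.diag_mul_pos hx (hMx i)) (hx i)

/-- Monotonicity of nonsingular M-matrices. -/
theorem nonneg_of_mulVec_nonneg {M : Matrix m m ℝ} (hM : IsZMatrix M) {x : m → ℝ}
    (hx : ∀ i, 0 < x i) (hMx : ∀ i, 0 < (M *ᵥ x) i) {y : m → ℝ} (hy : ∀ i, 0 ≤ (M *ᵥ y) i)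
    (i : m) : 0 ≤ y i := by
  -- Let t be the least ratio y/x, attained at k. If t < 0, then y - t x is nonnegative and vanishes
  -- at k, yet M maps it to something positive there, against `diag_mul_pos`.
  obtain ⟨k, -, hk⟩ := Finset.exists_min_image Finset.univ (fun i => y i / x i)
    ⟨i, Finset.mem_univ i⟩
  by_contra! hi
  set t := y k / x k with ht
  have ht0 : t < 0 := lt_of_le_of_lt (hk i (Finset.mem_univ i)) (div_neg_of_neg_of_pos hi (hx i))
  have hz : ∀ j, 0 ≤ (y - t • x) j := fun j => by
    have := (le_div_iff₀ (hx j)).1 (hk j (Finset.mem_univ j))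
    simpa using this
  have hzk : (y - t • x) k = 0 := by
    have := (hx k).ne'
    simp [ht, this]
  have hpos : 0 < (M *ᵥ (y - t • x)) k := by
    have h1 := mul_neg_of_neg_of_pos ht0 (hMx k)
    have h2 := hy k
    rw [mulVec_sub, mulVec_smul]
    simp only [Pi.sub_apply, Pi.smul_apply, smul_eq_mul]
    linarith
  have := hM.diag_mul_pos hz hpos
  rw [hzk, mul_zero] at this
  exact lt_irrefl _ this

/-- A nonsingular M-matrix has a positive determinant, bounded by the product of its diagonal. -/
theorem det_pos_and_le {n : ℕ} {M : Matrix (Fin n) (Fin n) ℝ} (hM : IsZMatrix M) {x : Fin n → ℝ}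
    (hx : ∀ i, 0 < x i) (hMx : ∀ i, 0 < (M *ᵥ x) i) : 0 < M.det ∧ M.det ≤ ∏ i, M i i := by
  induction n with
  | zero => simp
  | succ n ih =>
    have ha : 0 < M 0 0 := hM.diag_pos (fun i => (hx i).le) hMx 0
    -- The Schur complement of the corner entry: it is again a Z-matrix, lies entrywise below M, and
    -- inherits the positive vector.
    let S : Matrix (Fin n) (Fin n) ℝ := of fun i j =>
      M i.succ j.succ - M i.succ 0 / M 0 0 * M 0 j.succ
    have hle : ∀ i j, S i j ≤ M i.succ j.succ := fun i j => by
      have h1 := mul_nonneg_of_nonpos_of_nonpos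
        (div_nonpos_of_nonpos_of_nonneg (hM i.succ 0 (Fin.succ_ne_zero i)) ha.le)
        (hM 0 j.succ (Fin.succ_ne_zero j).symm)
      simp only [S, of_apply]
      linarith
    have hS : IsZMatrix S := fun i j hij =>
      (hle i j).trans (hM _ _ fun h => hij (Fin.succ_injective _ h))
    have hSx : ∀ i, 0 < (S *ᵥ fun j => x j.succ) i := fun i => by
      have h0 := hMx 0
      have hi := hMx i.succ
      simp only [mulVec, dotProduct, Fin.sum_univ_succ] at h0 hi
      -- Elimination adds a nonnegative multiple of row 0, so positivity of the image survives while
      -- the `x 0` terms cancel.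
      have hc : 0 ≤ -(M i.succ 0 / M 0 0) :=
        neg_nonneg.2 (div_nonpos_of_nonpos_of_nonneg (hM i.succ 0 (Fin.succ_ne_zero i)) ha.le)
      have h3 := mul_nonneg hc h0.le
      have h4 : M i.succ 0 / M 0 0 * (M 0 0 * x 0) = M i.succ 0 * x 0 := by
        field_simp
      have h5 : (S *ᵥ fun j => x j.succ) i = (∑ j : Fin n, M i.succ j.succ * x j.succ)
          - M i.succ 0 / M 0 0 * ∑ j : Fin n, M 0 j.succ * x j.succ := by
        simp only [mulVec, dotProduct, S, of_apply, sub_mul, Finset.sum_sub_distrib,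
          Finset.mul_sum, mul_assoc]
      rw [h5]
      linarith
    obtain ⟨hpos, hdet⟩ := ih hS (fun i => hx i.succ) hSx
    have hSd : ∀ i, 0 < S i i := hS.diag_pos (fun i => (hx i.succ).le) hSx
    have hMS : M.det = M 0 0 * S.det := by
      let B : Matrix (Fin (n + 1)) (Fin (n + 1)) ℝ := of fun i j =>
        M i j - (if i = 0 then 0 else M i 0 / M 0 0) * M 0 j
      have hB : M.det = B.det := det_eq_of_forall_row_eq_smul_add_const
        (fun i => if i = 0 then 0 else M i 0 / M 0 0) 0 (if_pos rfl) fun i j => by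
          simp [B]
      have hcol : ∀ i : Fin n, B i.succ 0 = 0 := fun i => by
        simp [B, Fin.succ_ne_zero, ha.ne']
      have hsub : B.submatrix Fin.succ Fin.succ = S := by
        ext i j
        simp [B, S, Fin.succ_ne_zero]
      rw [hB, det_succ_column_zero, Fin.sum_univ_succ]
      simp only [hcol, mul_zero, zero_mul, Finset.sum_const_zero, add_zero]
      have hz : (Fin.succAbove 0 : Fin n → Fin (n + 1)) = Fin.succ := Fin.succAbove_zero
      rw [hz, hsub]
      simp [B]
    rw [hMS, Fin.prod_univ_succ]
    refine ⟨mul_pos ha hpos, mul_le_mul_of_nonneg_left (hdet.trans ?_) ha.le⟩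
    exact Finset.prod_le_prod (fun i _ => (hSd i).le) fun i _ => hle i i

/-- M sends column j of its adjugate to det M times the j-th unit vector, which is nonnegative;
monotonicity applies. -/
theorem adjugate_nonneg {n : ℕ} {M : Matrix (Fin n) (Fin n) ℝ} (hM : IsZMatrix M) {x : Fin n → ℝ}
    (hx : ∀ i, 0 < x i) (hMx : ∀ i, 0 < (M *ᵥ x) i) (i j : Fin n) : 0 ≤ M.adjugate i j := by
  refine hM.nonneg_of_mulVec_nonneg hx hMx (y := fun k => M.adjugate k j) (fun k => ?_) i
  have h : (M *ᵥ fun k => M.adjugate k j) k = (M * M.adjugate) k j := rfl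
  rw [h, mul_adjugate, Matrix.smul_apply, one_apply, smul_eq_mul]
  have := (hM.det_pos_and_le hx hMx).1.le
  split_ifs <;> simp [this]

/-- A Z-matrix with positive determinant and nonnegative adjugate is a nonsingular M-matrix. -/
theorem exists_pos_of_adjugate_nonneg [DecidableEq m] {M : Matrix m m ℝ} (hM : IsZMatrix M)
    (hdet : 0 < M.det) (hadj : ∀ i j, 0 ≤ M.adjugate i j) :
    ∃ x : m → ℝ, (∀ i, 0 < x i) ∧ ∀ i, 0 < (M *ᵥ x) i := by
  -- The witness is the vector of row sums of the adjugate, which M maps to the constant vector det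
  -- M.
  have h0 : ∀ i, 0 ≤ (M.adjugate *ᵥ 1) i := fun i =>
    Finset.sum_nonneg fun j _ => mul_nonneg (hadj i j) zero_le_one
  have h1 : ∀ i, 0 < (M *ᵥ (M.adjugate *ᵥ 1)) i := fun i => by
    rw [mulVec_mulVec, mul_adjugate, smul_mulVec, one_mulVec]
    simpa using hdet
  exact ⟨_, hM.pos_of_nonneg h0 h1, h1⟩

end IsZMatrix

end ZMatrix

namespace RadialNetwork

/-! ### Paths in the tree and the inverse of the incidence matrix. -/

section Tree

variable {n : ℕ} (net : RadialNetwork n)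

theorem towardsRoot_succ (j : Fin n) : towardsRoot net.parent j.succ = net.parent j := rfl

theorem towardsRoot_iterate_zero (k : ℕ) : (towardsRoot net.parent)^[k] 0 = 0 :=
  Function.iterate_fixed rfl k

theorem not_mem_pathLines_zero (e : Fin n) : e ∉ net.pathLines 0 := by
  rintro ⟨k, hk⟩
  rw [towardsRoot_iterate_zero] at hk
  exact Fin.succ_ne_zero e hk.symm

theorem not_mem_pathLines_parent (j : Fin n) : j ∉ net.pathLines (net.parent j) := by
  rintro ⟨k, hk⟩
  rw [← towardsRoot_succ, ← Function.iterate_succ_apply] at hk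
  obtain ⟨l, hl⟩ := net.reaches_root j.succ
  -- A bus on its own parent's path would be periodic; but l of these (k + 1) * l steps already
  -- reach the root, which is fixed.
  have hper : (towardsRoot net.parent)^[(k + 1) * l] j.succ = j.succ := by
    rw [Function.iterate_mul]
    exact Function.iterate_fixed hk l
  rw [add_mul, one_mul, Function.iterate_add_apply, hl, towardsRoot_iterate_zero] at hper
  exact Fin.succ_ne_zero j hper.symm

theorem mem_pathLines_succ (e j : Fin n) :
    e ∈ net.pathLines j.succ ↔ e ∈ net.pathLines (net.parent j) ∨ e = j := by
  constructor
  · rintro ⟨k, hk⟩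
    cases k with
    | zero => exact Or.inr (Fin.succ_injective _ hk).symm
    | succ k => exact Or.inl ⟨k, hk⟩
  · rintro (⟨k, hk⟩ | rfl)
    · exact ⟨k + 1, hk⟩
    · exact ⟨0, rfl⟩

/-- The indicator of the line `e` lying on the path from the root to bus `i`. -/
noncomputable def onPath (e : Fin n) (i : Fin (n + 1)) : ℝ := (net.pathLines i).indicator 1 e

theorem onPath_zero (e : Fin n) : net.onPath e 0 = 0 :=
  Set.indicator_of_notMem (net.not_mem_pathLines_zero e) _

theorem onPath_parent_self (j : Fin n) : net.onPath j (net.parent j) = 0 :=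
  Set.indicator_of_notMem (net.not_mem_pathLines_parent j) _

theorem onPath_succ (e j : Fin n) :
    net.onPath e j.succ = net.onPath e (net.parent j) + if e = j then 1 else 0 := by
  classical
  by_cases hej : e = j
  · subst hej
    rw [onPath_parent_self, if_pos rfl, zero_add]
    exact Set.indicator_of_mem ((net.mem_pathLines_succ e e).2 (Or.inr rfl)) _
  · simp only [onPath, Set.indicator_apply, mem_pathLines_succ, hej, or_false, if_false, add_zero]

theorem onPath_succ_self (j : Fin n) : net.onPath j j.succ = 1 := by
  rw [onPath_succ, onPath_parent_self, if_pos rfl, zero_add]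

theorem onPath_nonneg (e : Fin n) (i : Fin (n + 1)) : 0 ≤ net.onPath e i :=
  Set.indicator_nonneg (fun _ _ => zero_le_one) _

theorem onPath_mul_self (e : Fin n) (i : Fin (n + 1)) :
    net.onPath e i * net.onPath e i = net.onPath e i := by
  classical
  simp [onPath, Set.indicator_apply]

/-- The path to the parent is part of the path to the bus. On the diagonal this collapses the double
path sums to `rPath` and `xPath`. -/
theorem onPath_parent_mul_succ (k j : Fin n) :
    net.onPath k (net.parent j) * net.onPath k j.succ = net.onPath k (net.parent j) := by
  rw [onPath_succ, mul_add, onPath_mul_self]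
  split_ifs with h
  · rw [h, onPath_parent_self]; simp
  · simp

theorem rPath_eq_sum (i : Fin (n + 1)) : net.rPath i = ∑ k, net.onPath k i * net.r k := by
  classical
  simp [rPath, onPath, Set.indicator_apply]

theorem xPath_eq_sum (i : Fin (n + 1)) : net.xPath i = ∑ k, net.onPath k i * net.x k := by
  classical
  simp [xPath, onPath, Set.indicator_apply]

/-- The path matrix: the entry at `(e, j)` tells whether line `e` lies on the path to bus `j.succ`. -/
noncomputable def pathMatrix : Matrix (Fin n) (Fin n) ℝ := of fun e j => net.onPath e j.succ

theorem pathMatrix_mul_Ao2 :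
    net.pathMatrix * net.Ao2 = of fun e j => net.onPath e (net.parent j) := by
  ext e j
  simp only [mul_apply, pathMatrix, Ao2, Ao, of_apply, submatrix_apply, id]
  rcases Fin.eq_zero_or_eq_succ (net.parent j) with h | ⟨k, h⟩
  · simp [h, Fin.succ_ne_zero, onPath_zero]
  · simp [h]

theorem A2_eq : net.A2 = net.Ao2 - 1 := by
  ext i j
  simp [A2, A, Ao2, Ai, one_apply]

/-- Columnwise this is `onPath_succ`: the paths to a bus and to its parent differ by exactly the
line joining them. -/
theorem neg_pathMatrix_mul_A2 : -net.pathMatrix * net.A2 = 1 := by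
  rw [A2_eq, mul_sub, neg_mul, pathMatrix_mul_Ao2]
  ext e j
  simp [pathMatrix, onPath_succ, one_apply]

theorem A2_inv : net.A2⁻¹ = -net.pathMatrix := inv_eq_left_inv net.neg_pathMatrix_mul_A2

theorem isUnit_A2_det : IsUnit net.A2.det := isUnit_det_of_left_inverse net.neg_pathMatrix_mul_A2

theorem Ao2_transpose_mul_inv :
    net.Ao2ᵀ * (net.A2ᵀ)⁻¹ = -of fun j e => net.onPath e (net.parent j) := by
  rw [← transpose_nonsing_inv, A2_inv, ← transpose_mul, neg_mul, pathMatrix_mul_Ao2]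
  rfl

end Tree

/-! ### Entries and signs of the reduced Jacobian. -/

section ReducedJacobian

variable {n : ℕ} (net : RadialNetwork n) (u : Vars n) (ξ : Params n)

theorem Ao_transpose_mulVec (v : Fin (n + 1) → ℝ) (j : Fin n) :
    (net.Aoᵀ *ᵥ v) j = v (net.parent j) := by
  simp [mulVec, dotProduct, Ao]

theorem Ai_transpose_mulVec (v : Fin (n + 1) → ℝ) (j : Fin n) :
    (net.Aiᵀ *ᵥ v) j = v j.succ := by
  simp [mulVec, dotProduct, Ai]

theorem Ai_mulVec_succ (w : Fin n → ℝ) (j : Fin n) : (net.Ai *ᵥ w) j.succ = w j := by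
  simp [mulVec, dotProduct, Ai]

theorem Ai_mulVec_zero (w : Fin n → ℝ) : (net.Ai *ᵥ w) 0 = 0 := by
  simp [mulVec, dotProduct, Ai, (Fin.succ_ne_zero _).symm]

theorem reducedJacobian_apply (i j : Fin n) :
    net.reducedJacobian u ξ i j =
      (if i = j then busV u ξ (net.parent i) else 0)
      - 2 * u.pLine i * net.onPath i j.succ * net.r j
      - 2 * u.qLine i * net.onPath i j.succ * net.x j
      + u.ell i * ((net.onPath j (net.parent i) * net.r j ^ 2
          - 2 * ∑ k, net.onPath k (net.parent i) * net.onPath k j.succ * (net.r k * net.r j))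
        + (net.onPath j (net.parent i) * net.x j ^ 2
          - 2 * ∑ k, net.onPath k (net.parent i) * net.onPath k j.succ * (net.x k * net.x j))) := by
  have hsum : (of (fun j e => net.onPath e (net.parent j)) * (diagonal net.r ^ 2
      + (2 : ℝ) • (diagonal net.r * -net.pathMatrix * diagonal net.r)
        + diagonal net.x ^ 2 + (2 : ℝ) • (diagonal net.x * -net.pathMatrix * diagonal net.x))) i j =
      (net.onPath j (net.parent i) * net.r j ^ 2
          - 2 * ∑ k, net.onPath k (net.parent i) * net.onPath k j.succ * (net.r k * net.r j))
        + (net.onPath j (net.parent i) * net.x j ^ 2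
          - 2 * ∑ k, net.onPath k (net.parent i) * net.onPath k j.succ * (net.x k * net.x j)) := by
    have h (y : Fin n → ℝ) : (of (fun j e => net.onPath e (net.parent j)) *
        (diagonal y * -net.pathMatrix * diagonal y)) i j =
        -∑ k, net.onPath k (net.parent i) * net.onPath k j.succ * (y k * y j) := by
      rw [mul_apply, ← Finset.sum_neg_distrib]
      refine Finset.sum_congr rfl fun k _ => ?_
      rw [mul_diagonal, diagonal_mul, Matrix.neg_apply, pathMatrix, of_apply, of_apply]
      ring
    simp only [mul_add, Matrix.add_apply, diagonal_pow, mul_diagonal, of_apply, Pi.pow_apply,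
      Matrix.mul_smul, Matrix.smul_apply, smul_eq_mul, h]
    ring
  rw [← hsum, reducedJacobian, Matrix.mul_assoc (diagonal u.ell), Ao2_transpose_mul_inv, A2_inv,
    Matrix.mul_assoc (diagonal u.ell), Matrix.sub_apply, diagonal_mul, neg_mul, Matrix.neg_apply]
  simp only [Matrix.add_apply, Matrix.smul_apply, mul_diagonal, diagonal_mul, diagonal_apply, Matrix.neg_apply,
    pathMatrix, of_apply, Ao_transpose_mulVec, smul_eq_mul]
  ring

theorem reducedJacobian_diag (j : Fin n) :
    net.reducedJacobian u ξ j j = net.diagEntry u ξ j := by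
  rw [reducedJacobian_apply, diagEntry, rPath_eq_sum, xPath_eq_sum]
  simp only [onPath_parent_mul_succ, onPath_parent_self, onPath_succ_self, if_true,
    ← mul_assoc, ← Finset.sum_mul]
  ring

/-- The left side is the summand k = j. Thus the squared impedance terms, which have the wrong sign,
are absorbed by the doubled path sums. -/
theorem onPath_mul_sq_le_sum {y : Fin n → ℝ} (hy : ∀ k, 0 ≤ y k) (i j : Fin n) :
    net.onPath j (net.parent i) * y j ^ 2 ≤
      ∑ k, net.onPath k (net.parent i) * net.onPath k j.succ * (y k * y j) := by
  have h := Finset.single_le_sum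
    (f := fun k => net.onPath k (net.parent i) * net.onPath k j.succ * (y k * y j))
    (fun k _ => mul_nonneg (mul_nonneg (net.onPath_nonneg _ _) (net.onPath_nonneg _ _))
      (mul_nonneg (hy k) (hy j))) (Finset.mem_univ j)
  simp only [onPath_succ_self, mul_one, ← sq] at h
  exact h

variable {u}

/-- With nonnegative line flows and currents, only the voltages contribute positive entries. -/
theorem reducedJacobian_le (hp : ∀ j, 0 ≤ u.pLine j) (hq : ∀ j, 0 ≤ u.qLine j)
    (hl : ∀ j, 0 ≤ u.ell j) (i j : Fin n) :
    net.reducedJacobian u ξ i j ≤ if i = j then busV u ξ (net.parent i) else 0 := by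
  have hterm : ∀ y : Fin n → ℝ, (∀ k, 0 ≤ y k) → net.onPath j (net.parent i) * y j ^ 2
      - 2 * ∑ k, net.onPath k (net.parent i) * net.onPath k j.succ * (y k * y j) ≤ 0 := by
    intro y hy
    have h1 := net.onPath_mul_sq_le_sum hy i j
    have h2 := mul_nonneg (net.onPath_nonneg j (net.parent i)) (sq_nonneg (y j))
    linarith
  have h1 := mul_nonpos_of_nonneg_of_nonpos (hl i)
    (add_nonpos (hterm _ net.r_nonneg) (hterm _ net.x_nonneg))
  have h2 : 0 ≤ 2 * u.pLine i * net.onPath i j.succ * net.r j :=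
    mul_nonneg (mul_nonneg (mul_nonneg zero_le_two (hp i)) (net.onPath_nonneg _ _))
      (net.r_nonneg j)
  have h3 : 0 ≤ 2 * u.qLine i * net.onPath i j.succ * net.x j :=
    mul_nonneg (mul_nonneg (mul_nonneg zero_le_two (hq i)) (net.onPath_nonneg _ _))
      (net.x_nonneg j)
  rw [reducedJacobian_apply]
  linarith

theorem isZMatrix_reducedJacobian (hp : ∀ j, 0 ≤ u.pLine j) (hq : ∀ j, 0 ≤ u.qLine j)
    (hl : ∀ j, 0 ≤ u.ell j) : IsZMatrix (net.reducedJacobian u ξ) := fun i j hij => by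
  simpa [hij] using net.reducedJacobian_le ξ hp hq hl i j

end ReducedJacobian

/-! ### Signs of flows and currents at solutions. -/

section Solutions

variable {n : ℕ} (net : RadialNetwork n) {u : Vars n} {ξ : Params n}

theorem Ao_mulVec_succ (w : Fin n → ℝ) (j : Fin n) :
    (net.Ao *ᵥ w) j.succ = (net.Ao2 *ᵥ w) j := rfl

/-- Solving the balance gives f as the path matrix, which is nonnegative, applied to g. -/
theorem nonneg_of_flow_balance {f g : Fin n → ℝ} (hg : ∀ j, 0 ≤ g j)
    (h : ∀ j, f j - (net.Ao2 *ᵥ f) j = g j) (j : Fin n) : 0 ≤ f j := by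
  have h1 : -(net.A2 *ᵥ f) = g := by
    ext k
    rw [A2_eq, sub_mulVec, one_mulVec, ← h k]
    simp
  have h2 : f = net.pathMatrix *ᵥ g := by
    rw [← h1, mulVec_neg, ← neg_mulVec, mulVec_mulVec, neg_pathMatrix_mul_A2, one_mulVec]
  rw [h2, mulVec, dotProduct]
  exact Finset.sum_nonneg fun k _ => mul_nonneg (net.onPath_nonneg _ _) (hg k)

theorem flows_nonneg (hphi : net.phi u ξ = 0) (hD : ξ ∈ loadParams n) (hl : ∀ j, 0 ≤ u.ell j) :
    (∀ j, 0 ≤ u.pLine j) ∧ ∀ j, 0 ≤ u.qLine j := by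
  constructor
  · refine net.nonneg_of_flow_balance (g := fun j => ξ.pPQ j + net.r j * u.ell j)
      (fun j => add_nonneg (hD j).1 (mul_nonneg (net.r_nonneg j) (hl j))) fun j => ?_
    have h := congrFun hphi (.inl j.succ)
    simp only [phi, Sum.elim_inl, Pi.sub_apply, Ai_mulVec_succ, mulVec_diagonal, Ao_mulVec_succ,
      busP, Fin.cons_succ, Pi.zero_apply] at h
    linarith
  · refine net.nonneg_of_flow_balance (g := fun j => ξ.qPQ j + net.x j * u.ell j)
      (fun j => add_nonneg (hD j).2 (mul_nonneg (net.x_nonneg j) (hl j))) fun j => ?_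
    have h := congrFun hphi (.inr (.inl j.succ))
    simp only [phi, Sum.elim_inl, Sum.elim_inr, Pi.sub_apply, Ai_mulVec_succ, mulVec_diagonal,
      Ao_mulVec_succ, busQ, Fin.cons_succ, Pi.zero_apply] at h
    linarith

theorem ell_nonneg (hphi : net.phi u ξ = 0) {j : Fin n} (hv : 0 < busV u ξ (net.parent j)) :
    0 ≤ u.ell j := by
  have h := congrFun hphi (.inr (.inr (.inr j)))
  simp only [phi, Sum.elim_inr, Pi.sub_apply, Pi.add_apply, mulVec_diagonal,
    Ao_transpose_mulVec, Pi.zero_apply] at h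
  refine nonneg_of_mul_nonneg_right (a := busV u ξ (net.parent j)) ?_ hv
  nlinarith [mul_self_nonneg (u.pLine j), mul_self_nonneg (u.qLine j)]

end Solutions

/-! ### The full Jacobian and its relation to the reduced one. -/

section Jacobian

variable {n : ℕ} (net : RadialNetwork n) (u d : Vars n) (ξ : Params n)

/-- The derivative of `phi` with respect to the variables, in direction `d`. -/
def phiDeriv : EqIdx n → ℝ :=
  Sum.elim
    (net.Ai *ᵥ (d.pLine - diagonal net.r *ᵥ d.ell) - net.Ao *ᵥ d.pLine - busP d 0)
    (Sum.elim
      (net.Ai *ᵥ (d.qLine - diagonal net.x *ᵥ d.ell) - net.Ao *ᵥ d.qLine - busQ d 0)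
      (Sum.elim
        (net.Aoᵀ *ᵥ busV d 0
          - (2 : ℝ) • (diagonal net.r *ᵥ d.pLine + diagonal net.x *ᵥ d.qLine)
          + (diagonal net.r ^ 2 + diagonal net.x ^ 2) *ᵥ d.ell - net.Aiᵀ *ᵥ busV d 0)
        ((2 : ℝ) • (diagonal u.pLine *ᵥ d.pLine + diagonal u.qLine *ᵥ d.qLine)
          - diagonal (net.Aoᵀ *ᵥ busV u ξ) *ᵥ d.ell - diagonal u.ell *ᵥ (net.Aoᵀ *ᵥ busV d 0))))

/-- The direction carries parameter 0 because the parameters stay fixed. -/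
theorem busV_add_smul (t : ℝ) : busV (u + t • d) ξ = busV u ξ + t • busV d 0 := by
  ext i
  refine Fin.cases ?_ (fun j => ?_) i <;> simp [busV, Vars.vPQ, Params.vSlack]

theorem busP_add_smul (t : ℝ) : busP (u + t • d) ξ = busP u ξ + t • busP d 0 := by
  ext i
  refine Fin.cases ?_ (fun j => ?_) i <;> simp [busP, Vars.pSlack, Params.pPQ]

theorem busQ_add_smul (t : ℝ) : busQ (u + t • d) ξ = busQ u ξ + t • busQ d 0 := by
  ext i
  refine Fin.cases ?_ (fun j => ?_) i <;> simp [busQ, Vars.qSlack, Params.qPQ]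

/-- Second order Taylor expansion of `phi`. -/
theorem phi_add_smul : ∃ c : EqIdx n → ℝ, ∀ t : ℝ,
    net.phi (u + t • d) ξ = net.phi u ξ + t • net.phiDeriv u d ξ + t ^ 2 • c := by
  refine ⟨Sum.elim 0 (Sum.elim 0 (Sum.elim 0 (diagonal d.pLine *ᵥ d.pLine
    + diagonal d.qLine *ᵥ d.qLine - diagonal (net.Aoᵀ *ᵥ busV d 0) *ᵥ d.ell))), fun t => ?_⟩
  have hp : (u + t • d).pLine = u.pLine + t • d.pLine := rfl
  have hq : (u + t • d).qLine = u.qLine + t • d.qLine := rfl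
  have hl : (u + t • d).ell = u.ell + t • d.ell := rfl
  funext i
  rcases i with i | i | i | i <;>
    simp only [phi, phiDeriv, hp, hq, hl, busV_add_smul, busP_add_smul, busQ_add_smul, mulVec_add,
      mulVec_sub, mulVec_smul, Sum.elim_inl, Sum.elim_inr, Pi.add_apply, Pi.sub_apply,
      Pi.smul_apply, Pi.zero_apply, smul_eq_mul, mulVec_diagonal] <;> ring

theorem differentiable_phi : Differentiable ℝ fun w : Vars n => net.phi w ξ := by
  have hP : Differentiable ℝ fun w : Vars n => busP w ξ := by
    refine differentiable_pi.2 fun i => Fin.cases ?_ (fun j => ?_) i <;>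
      simp only [busP, Fin.cons_zero, Fin.cons_succ, Vars.pSlack] <;> fun_prop
  have hQ : Differentiable ℝ fun w : Vars n => busQ w ξ := by
    refine differentiable_pi.2 fun i => Fin.cases ?_ (fun j => ?_) i <;>
      simp only [busQ, Fin.cons_zero, Fin.cons_succ, Vars.qSlack] <;> fun_prop
  have hV : Differentiable ℝ fun w : Vars n => busV w ξ := by
    refine differentiable_pi.2 fun i => Fin.cases ?_ (fun j => ?_) i <;>
      simp only [busV, Fin.cons_zero, Fin.cons_succ, Vars.vPQ] <;> fun_prop
  have hP' := differentiable_pi.1 hP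
  have hQ' := differentiable_pi.1 hQ
  have hV' := differentiable_pi.1 hV
  refine differentiable_pi.2 fun i => ?_
  rcases i with i | i | i | i <;>
    simp only [phi, Sum.elim_inl, Sum.elim_inr, Pi.add_apply, Pi.sub_apply, Pi.smul_apply,
      mulVec_diagonal, Ao_transpose_mulVec] <;>
    simp only [mulVec, dotProduct, Pi.sub_apply, Vars.pLine, Vars.qLine, Vars.ell] <;> fun_prop

theorem fderiv_phi_apply : fderiv ℝ (fun w : Vars n => net.phi w ξ) u d = net.phiDeriv u d ξ := by
  rw [← ((net.differentiable_phi ξ) u).lineDeriv_eq_fderiv]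
  refine HasLineDerivAt.lineDeriv ?_
  obtain ⟨c, hc⟩ := net.phi_add_smul u d ξ
  simp only [HasLineDerivAt, hc]
  have h1 := ((hasDerivAt_id (0 : ℝ)).smul_const (net.phiDeriv u d ξ)).const_add (net.phi u ξ)
  have h2 := ((hasDerivAt_id (0 : ℝ)).pow 2).smul_const c
  have h := h1.add h2
  simp only [id, one_smul, Nat.cast_ofNat, Nat.add_one_sub_one, pow_one, mul_zero, zero_mul,
    zero_smul, add_zero] at h
  exact h

theorem jacobian_det_eq_zero (hd : d ≠ 0) (h : net.phiDeriv u d ξ = 0) :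
    (net.jacobian u ξ).det = 0 := by
  refine exists_mulVec_eq_zero_iff.1 ⟨d ∘ (varOrder n).symm, fun h0 => hd ?_, ?_⟩
  · funext k
    simpa using congrFun h0 (varOrder n k)
  · have hJ : (of fun i k => fderiv ℝ (fun w : Vars n => net.phi w ξ) u (Pi.single k 1) i) *ᵥ d
        = 0 := by
      rw [← h, ← fderiv_phi_apply]
      funext i
      conv_rhs => rw [pi_eq_sum_univ' d]
      simp [mulVec, dotProduct, mul_comm]
    rw [jacobian, reindex_apply, submatrix_mulVec_equiv]
    simp [Function.comp_assoc, hJ]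

/-- A kernel vector w of the reduced Jacobian, read as a variation of ℓ, extends to a kernel vector
of the full one. The linear equations determine the other variations through the invertible `A2`,
and the linearized current equation then reads -Mw = 0. -/
theorem reducedJacobian_det_ne_zero (h : (net.jacobian u ξ).det ≠ 0) :
    (net.reducedJacobian u ξ).det ≠ 0 := by
  intro h0
  obtain ⟨w, hw, hMw⟩ := exists_mulVec_eq_zero_iff.2 h0
  refine h ?_
  let dp : Fin n → ℝ := -(net.A2⁻¹ *ᵥ (diagonal net.r *ᵥ w))
  let dq : Fin n → ℝ := -(net.A2⁻¹ *ᵥ (diagonal net.x *ᵥ w))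
  let s : Fin n → ℝ := (2 : ℝ) • (diagonal net.r *ᵥ dp + diagonal net.x *ᵥ dq)
    - (diagonal net.r ^ 2 + diagonal net.x ^ 2) *ᵥ w
  let dv : Fin n → ℝ := (net.A2ᵀ)⁻¹ *ᵥ s
  -- The slack entries are chosen to satisfy the two balances at the root.
  let d : Vars n := Sum.elim dp (Sum.elim dq (Sum.elim w (Sum.elim dv
    (Sum.elim (fun _ => -(net.Ao *ᵥ dp) 0) (fun _ => -(net.Ao *ᵥ dq) 0)))))
  have hdp : dp - net.Ao2 *ᵥ dp = diagonal net.r *ᵥ w := by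
    have : net.A2 *ᵥ dp = -(diagonal net.r *ᵥ w) := by
      rw [mulVec_neg, mulVec_mulVec, mul_nonsing_inv _ net.isUnit_A2_det, one_mulVec]
    rw [A2_eq, sub_mulVec, one_mulVec] at this
    rw [← neg_inj, ← this, neg_sub]
  have hdq : dq - net.Ao2 *ᵥ dq = diagonal net.x *ᵥ w := by
    have : net.A2 *ᵥ dq = -(diagonal net.x *ᵥ w) := by
      rw [mulVec_neg, mulVec_mulVec, mul_nonsing_inv _ net.isUnit_A2_det, one_mulVec]
    rw [A2_eq, sub_mulVec, one_mulVec] at this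
    rw [← neg_inj, ← this, neg_sub]
  have hdv : net.Ao2ᵀ *ᵥ dv - dv = s := by
    have : net.A2ᵀ *ᵥ dv = s := by
      rw [mulVec_mulVec, mul_nonsing_inv _ (by rw [det_transpose]; exact net.isUnit_A2_det),
        one_mulVec]
    rwa [A2_eq, transpose_sub, transpose_one, sub_mulVec, one_mulVec] at this
  have hAoV : net.Aoᵀ *ᵥ busV d 0 = net.Ao2ᵀ *ᵥ dv := by
    funext j
    simp only [mulVec, dotProduct, Fin.sum_univ_succ, busV, Fin.cons_zero, Fin.cons_succ]
    simp [Params.vSlack, Vars.vPQ, d, Ao2]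
  have hlast : (2 : ℝ) • (diagonal u.pLine *ᵥ dp + diagonal u.qLine *ᵥ dq)
      - diagonal (net.Aoᵀ *ᵥ busV u ξ) *ᵥ w - diagonal u.ell *ᵥ (net.Ao2ᵀ *ᵥ dv) = 0 := by
    rw [← neg_eq_zero, ← hMw]
    simp only [reducedJacobian, dv, s, dp, dq, add_mulVec, sub_mulVec, smul_mulVec, ← mulVec_mulVec,
      mulVec_add, mulVec_sub, mulVec_neg, mulVec_smul, smul_add, smul_neg]
    abel
  refine net.jacobian_det_eq_zero u d ξ (fun hd0 => hw ?_) ?_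
  · funext j
    exact congrFun hd0 (.inr (.inr (.inl j)))
  · funext i
    have ep : d.pLine = dp := rfl
    have eq : d.qLine = dq := rfl
    have el : d.ell = w := rfl
    rcases i with i | i | i | i
    · simp only [phiDeriv, Sum.elim_inl, ep, el, Pi.sub_apply, Pi.zero_apply]
      refine Fin.cases ?_ (fun j => ?_) i
      · rw [Ai_mulVec_zero]
        simp [busP, Vars.pSlack, d]
      · have := congrFun hdp j
        rw [Ai_mulVec_succ, Ao_mulVec_succ]
        simp only [Pi.sub_apply, busP, Fin.cons_succ, Params.pPQ, Pi.zero_apply] at this ⊢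
        linarith
    · simp only [phiDeriv, Sum.elim_inl, Sum.elim_inr, eq, el, Pi.sub_apply, Pi.zero_apply]
      refine Fin.cases ?_ (fun j => ?_) i
      · rw [Ai_mulVec_zero]
        simp [busQ, Vars.qSlack, d]
      · have := congrFun hdq j
        rw [Ai_mulVec_succ, Ao_mulVec_succ]
        simp only [Pi.sub_apply, busQ, Fin.cons_succ, Params.qPQ, Pi.zero_apply] at this ⊢
        linarith
    · simp only [phiDeriv, Sum.elim_inl, Sum.elim_inr, ep, eq, el, hAoV]
      have := congrFun hdv i
      have hAi : (net.Aiᵀ *ᵥ busV d 0) i = dv i := Ai_transpose_mulVec net _ i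
      simp only [Pi.sub_apply, Pi.add_apply, Pi.zero_apply, hAi, s] at this ⊢
      linarith
    · simp only [phiDeriv, Sum.elim_inr, ep, eq, el, hAoV]
      exact congrFun hlast i

end Jacobian

/-! ### The connectedness argument on the stability region. -/

section Stability

variable {n : ℕ} (net : RadialNetwork n)

theorem continuous_busV : Continuous fun s : Vars n × Params n => busV s.1 s.2 := by
  refine continuous_pi fun i => Fin.cases ?_ (fun j => ?_) i <;>
    simp only [busV, Fin.cons_zero, Fin.cons_succ, Vars.vPQ, Params.vSlack] <;> fun_prop

theorem continuous_reducedJacobian :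
    Continuous fun s : Vars n × Params n => net.reducedJacobian s.1 s.2 := by
  have hV (i : Fin (n + 1)) : Continuous fun s : Vars n × Params n => busV s.1 s.2 i :=
    (continuous_apply i).comp continuous_busV
  refine continuous_pi fun i => continuous_pi fun j => ?_
  simp only [reducedJacobian_apply, Vars.pLine, Vars.qLine, Vars.ell]
  have : Continuous fun s : Vars n × Params n =>
      if i = j then busV s.1 s.2 (net.parent i) else 0 := by
    split_ifs
    · exact hV _
    · exact continuous_const
  fun_prop

/-- States with nonnegative currents whose reduced Jacobian has nonnegative determinant and
adjugate; where the power flow Jacobian is nonsingular, these are nonsingular M-matrices. -/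
def monotoneStates : Set (Vars n × Params n) :=
  {s | (∀ j, 0 ≤ s.1.ell j) ∧ 0 ≤ (net.reducedJacobian s.1 s.2).det ∧
    ∀ i j, 0 ≤ (net.reducedJacobian s.1 s.2).adjugate i j}

theorem isClosed_monotoneStates : IsClosed net.monotoneStates := by
  have hM := net.continuous_reducedJacobian
  simp only [monotoneStates, Set.ofPred_and, Set.ofPred_forall]
  refine IsClosed.inter (isClosed_iInter fun j => ?_) (IsClosed.inter ?_
    (isClosed_iInter fun i => isClosed_iInter fun j => ?_))
  · exact isClosed_le continuous_const (by simp only [Vars.ell]; fun_prop)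
  · exact isClosed_le continuous_const hM.matrix_det
  · exact isClosed_le continuous_const (hM.matrix_adjugate.matrix_elem i j)

variable {net}

theorem isZMatrix_of_mem {s : Vars n × Params n} (hs : s ∈ net.regularSolutions (loadParams n))
    (hl : ∀ j, 0 ≤ s.1.ell j) : IsZMatrix (net.reducedJacobian s.1 s.2) :=
  have h := net.flows_nonneg hs.1 hs.2.2.1 hl
  net.isZMatrix_reducedJacobian s.2 h.1 h.2 hl

theorem exists_pos_of_mem {s : Vars n × Params n} (hs : s ∈ net.regularSolutions (loadParams n))
    (hm : s ∈ net.monotoneStates) : ∃ x : Fin n → ℝ, (∀ i, 0 < x i) ∧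
      ∀ i, 0 < (net.reducedJacobian s.1 s.2 *ᵥ x) i :=
  (isZMatrix_of_mem hs hm.1).exists_pos_of_adjugate_nonneg
    (lt_of_le_of_ne hm.2.1 (net.reducedJacobian_det_ne_zero _ _ hs.2.2.2).symm) hm.2.2

/-- The voltage bounds the corresponding diagonal entry from above, and an M-matrix has a positive
diagonal. -/
theorem busV_parent_pos {s : Vars n × Params n} (hs : s ∈ net.regularSolutions (loadParams n))
    (hm : s ∈ net.monotoneStates) (j : Fin n) : 0 < busV s.1 s.2 (net.parent j) := by
  obtain ⟨x, hx, hMx⟩ := exists_pos_of_mem hs hm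
  have hpos := (isZMatrix_of_mem hs hm.1).diag_pos (fun i => (hx i).le) hMx j
  have h := net.flows_nonneg hs.1 hs.2.2.1 hm.1
  simpa using hpos.trans_le (net.reducedJacobian_le s.2 h.1 h.2 hm.1 j j)

/-- Relative openness of the monotone states among the regular solutions. -/
theorem exists_isOpen_subset_monotoneStates {s : Vars n × Params n}
    (hs : s ∈ net.regularSolutions (loadParams n)) (hm : s ∈ net.monotoneStates) :
    ∃ U, IsOpen U ∧ s ∈ U ∧ U ∩ net.regularSolutions (loadParams n) ⊆ net.monotoneStates := by
  obtain ⟨x, hx, hMx⟩ := exists_pos_of_mem hs hm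
  -- The vector x found at s is kept fixed, so both conditions are finitely many strict inequalities
  -- between continuous functions.
  refine ⟨(⋂ j, {z | 0 < busV z.1 z.2 (net.parent j)}) ∩
    ⋂ i, {z | 0 < (net.reducedJacobian z.1 z.2 *ᵥ x) i}, IsOpen.inter ?_ ?_, ⟨?_, ?_⟩, ?_⟩
  · exact isOpen_iInter_of_finite fun j =>
      isOpen_lt continuous_const ((continuous_apply _).comp continuous_busV)
  · exact isOpen_iInter_of_finite fun i => isOpen_lt continuous_const
      ((continuous_apply i).comp (net.continuous_reducedJacobian.matrix_mulVec continuous_const))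
  · exact Set.mem_iInter.2 (busV_parent_pos hs hm)
  · exact Set.mem_iInter.2 hMx
  · rintro z ⟨⟨hv, hz⟩, hreg⟩
    have hl : ∀ j, 0 ≤ z.1.ell j := fun j => net.ell_nonneg hreg.1 (Set.mem_iInter.1 hv j)
    have hZ := isZMatrix_of_mem hreg hl
    have hzx := Set.mem_iInter.1 hz
    exact ⟨hl, (hZ.det_pos_and_le hx hzx).1.le, hZ.adjugate_nonneg hx hzx⟩

theorem flat_mem_monotoneStates : (flatVars n, flatParams n) ∈ net.monotoneStates := by
  have hV : ∀ i, busV (flatVars n) (flatParams n) i = 1 := fun i => by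
    refine Fin.cases ?_ (fun j => ?_) i <;>
      simp [busV, Vars.vPQ, Params.vSlack, flatVars, flatParams]
  have hM : net.reducedJacobian (flatVars n) (flatParams n) = 1 := by
    ext i j
    rw [reducedJacobian_apply, hV, one_apply]
    simp [Vars.pLine, Vars.qLine, Vars.ell, flatVars]
  refine ⟨fun j => le_rfl, ?_, fun i j => ?_⟩
  · simp [hM]
  · simp only [hM, adjugate_one, one_apply]
    split_ifs <;> simp

theorem voltageStabilityRegion_subset_monotoneStates :
    net.voltageStabilityRegion (loadParams n) ⊆ net.monotoneStates := by
  intro s hs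
  have hsub := connectedComponentIn_subset (net.regularSolutions (loadParams n))
    (flatVars n, flatParams n)
  -- Regularity of the flat solution needs no computation: otherwise the component would be empty,
  -- but it contains s.
  have hflat : (flatVars n, flatParams n) ∈ net.voltageStabilityRegion (loadParams n) :=
    mem_connectedComponentIn (connectedComponentIn_nonempty_iff.1 ⟨s, hs⟩)
  choose! U hUo hmU hUsub using fun z : Vars n × Params n =>
    fun hz : z ∈ net.regularSolutions (loadParams n) ∩ net.monotoneStates =>
      exists_isOpen_subset_monotoneStates hz.1 hz.2
  by_contra hns
  -- If s were not monotone, the neighbourhoods of monotone states and the complement of the closed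
  -- set would be two open sets covering the component, each meeting it. Preconnectedness yields a
  -- common point, which is both monotone and not.
  obtain ⟨z, hz, hzV, hzc⟩ := isPreconnected_connectedComponentIn
    (⋃ z ∈ net.regularSolutions (loadParams n) ∩ net.monotoneStates, U z) net.monotoneStatesᶜ
    (isOpen_biUnion hUo) net.isClosed_monotoneStates.isOpen_compl
    (fun z hz => by
      by_cases hm : z ∈ net.monotoneStates
      · exact Or.inl (Set.mem_biUnion ⟨hsub hz, hm⟩ (hmU z ⟨hsub hz, hm⟩))
      · exact Or.inr hm)
    ⟨_, hflat, Set.mem_biUnion ⟨hsub hflat, flat_mem_monotoneStates⟩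
      (hmU _ ⟨hsub hflat, flat_mem_monotoneStates⟩)⟩
    ⟨s, hs, hns⟩
  obtain ⟨y, hy, hzy⟩ := Set.mem_iUnion₂.1 hzV
  exact hzc (hUsub y hy ⟨hzy, hsub hz⟩)

end Stability

end RadialNetwork

theorem mainTheorem2 {n : ℕ} (net : RadialNetwork n) (u : Vars n) (ξ : Params n)
    (h : (u, ξ) ∈ net.voltageStabilityRegion (loadParams n)) :
    (∀ j, net.reducedJacobian u ξ j j = net.diagEntry u ξ j) ∧
      0 < (net.reducedJacobian u ξ).det ∧
      (net.reducedJacobian u ξ).det ≤ net.detApprox u ξ := by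
  have hreg := connectedComponentIn_subset _ _ h
  have hm := RadialNetwork.voltageStabilityRegion_subset_monotoneStates h
  obtain ⟨x, hx, hMx⟩ := RadialNetwork.exists_pos_of_mem hreg hm
  have hdet := (RadialNetwork.isZMatrix_of_mem hreg hm.1).det_pos_and_le hx hMx
  refine ⟨net.reducedJacobian_diag u ξ, hdet.1, hdet.2.trans_eq ?_⟩
  exact Finset.prod_congr rfl fun j _ => net.reducedJacobian_diag u ξ j
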